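/- A \emph{Heyting category} is a regular category in which every poset $\mathrm{Sub}(A)$ of subobjects has finite joins, preserved by the pullback maps $f^{*}$, and in which every pullback map $f^{*}:\mathrm{Sub}(B)\to\mathrm{Sub}(A)$ has a right adjoint $\forall_f$. A monomorphism $p$ is \emph{generic} if every monomorphism is a pullback of $p$ along some (not necessarily unique) morphism. A comonad is \emph{Cartesian} if its underlying functor preserves finite limits. An \emph{internal preorder} on an object $X$ is a jointly monic pair $R\rightrightarrows X$ that is reflexive and transitive; for morphisms $x,y:I\to X$ write $x\le y$ if $(x,y)$ factors through $R$. Internal preorders form a $2$-category with monotone maps as morphisms and with a (unique) $2$-cell $f\Rightarrow g$ exactly when $f\le g$. A comonad on an internal preorder is thus a monotone endomap $\beta$ with $\beta\le\mathrm{id}$ and $\beta\le\beta\beta$, and its object of coalgebras is the inserter of $\mathrm{id}$ and $\beta$. \textbf{Theorem.} Let $\mathbf{C}$ be a Heyting category that admits a generic monomorphism and let $(\Box,\varepsilon,\delta)$ be a Cartesian comonad on $\mathbf{C}$. Then the category $\mathbf{C}^{\Box}$ of $\Box$-coalgebras is again a Heyting category that admits a generic monomorphism. Moreover, let $U\dashv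 F:\mathbf{C}\to\mathbf{C}^{\Box}$ be the forgetful--cofree adjunction and let $p:\Omega_\bullet\to\Omega$ be any generic monomorphism of $\mathbf{C}$. Then there is an internal preorder $\pmb{\Omega}$ on $\Omega$ such that, for all $x,y:I\to\Omega$, $x\le y$ if and only if $x^{*}p\le y^{*}p$ in $\mathrm{Sub}(I)$, and there is a pullback square $$\begin{array}{ccc}\Box\Omega_\bullet&\xrightarrow{\ \chi_\bullet\ }&\Omega_\bullet\\ {\scriptstyle\Box p}\downarrow&&\downarrow{\scriptstyle p}\\ \Box\Omega&\xrightarrow{\ \chi\ }&\Omega.\end{array}$$ For any such $\pmb{\Omega}$, $\chi$, $\chi_\bullet$, let $\pmb{\Omega}_\bullet$ be the preorder on $\Omega_\bullet$ induced from $\pmb{\Omega}$ along $p$, and let $\beta:F\Omega\to F\Omega$ and $\beta_\bullet:F\Omega_\bullet\to F\Omega_\bullet$ be the transposes of $\chi:UF\Omega=\Box\Omega\to\Omega$ and $\chi_\bullet:UF\Omega_\bullet=\Box\Omega_\bullet\to\Omega_\bullet$. Then $\beta$ and $\beta_\bullet$ are comonads on the internal preorders $F\pmb{\Omega}$ and $F\pmb{\Omega}_\bullet$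 of $\mathbf{C}^{\Box}$; the map $Fp:F\pmb{\Omega}_\bullet\to F\pmb{\Omega}$ is monotone and $Fp\circ\beta_\bullet=\beta\circ Fp$; the objects of coalgebras $(F\pmb{\Omega}_\bullet)^{\beta_\bullet}$ and $(F\pmb{\Omega})^{\beta}$ (the inserters of $\mathrm{id}$ and $\beta_\bullet$, respectively of $\mathrm{id}$ and $\beta$) exist; there is a unique monotone map $(F\pmb{\Omega}_\bullet)^{\beta_\bullet}\to(F\pmb{\Omega})^{\beta}$ compatible with $Fp$; and this map is a generic monomorphism of $\mathbf{C}^{\Box}$. -/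

import Mathlib

open CategoryTheory Limits

universe v u

namespace HeytGen

/-- A coherent category: a regular category in which every poset of subobjects has finite joins
(a least element and binary joins), and these are preserved by pullback. -/
class CoherentCategory (C : Type u) [Category.{v} C] : Prop extends Regular C where
  exists_isBot : ∀ A : C, ∃ S : Subobject A, IsBot S
  exists_isLUB : ∀ {A : C} (S T : Subobject A), ∃ U : Subobject A, IsLUB {S, T} U
  pullback_isBot : ∀ {A B : C} (f : A ⟶ B) (S : Subobject B), IsBot S →
    IsBot ((Subobject.pullback f).obj S)
  pullback_isLUB : ∀ {A B : C} (f : A ⟶ B) (S T U : Subobject B), IsLUB {S, T} U →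
    IsLUB {(Subobject.pullback f).obj S, (Subobject.pullback f).obj T}
      ((Subobject.pullback f).obj U)

/-- A Heyting category: a coherent category in which every pullback map
`f⁻¹ : Sub B → Sub A` has a right adjoint `∀_f`. -/
class HeytingCategory (C : Type u) [Category.{v} C] : Prop extends CoherentCategory C where
  pullback_isLeftAdjoint : ∀ {A B : C} (f : A ⟶ B), (Subobject.pullback f).IsLeftAdjoint

/-- A monomorphism `p` is generic if every monomorphism is a pullback of `p`
(along some morphism, not necessarily unique). -/
structure IsGenericMono {C : Type u} [Category.{v} C] {E B : C} (p : E ⟶ B) : Prop where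
  mono : Mono p
  exists_isPullback : ∀ {X Y : C} (m : X ⟶ Y) [Mono m],
    ∃ (t : X ⟶ E) (c : Y ⟶ B), IsPullback t m p c

/-- The category admits a generic monomorphism. -/
def HasGenericMono (C : Type u) [Category.{v} C] : Prop :=
  ∃ (E B : C) (p : E ⟶ B), IsGenericMono p

/-- An internal preorder on an object `X`: a jointly monic pair `rel ⇉ X` which is reflexive and
transitive. -/
structure InternalPreorder {C : Type u} [Category.{v} C] (X : C) where
  rel : C
  d₀ : rel ⟶ X
  d₁ : rel ⟶ X
  jointly_mono : ∀ {I : C} (a b : I ⟶ rel), a ≫ d₀ = b ≫ d₀ → a ≫ d₁ = b ≫ d₁ → a = b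
  refl : ∃ r : X ⟶ rel, r ≫ d₀ = 𝟙 X ∧ r ≫ d₁ = 𝟙 X
  trans : ∀ {I : C} (a b : I ⟶ rel), a ≫ d₁ = b ≫ d₀ →
    ∃ c : I ⟶ rel, c ≫ d₀ = a ≫ d₀ ∧ c ≫ d₁ = b ≫ d₁

namespace InternalPreorder

variable {C : Type u} [Category.{v} C]

/-- The preorder on generalized elements: `x ≤ y` iff `(x, y)` factors through the relation.
For internal functors `x`, `y` this is also the existence of the (unique) internal natural
transformation `x ⇒ y`. -/
def le {X : C} (P : InternalPreorder X) {I : C} (x y : I ⟶ X) : Prop :=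
  ∃ h : I ⟶ P.rel, h ≫ P.d₀ = x ∧ h ≫ P.d₁ = y

/-- `f` is monotone, i.e. (the object part of) an internal functor. -/
def IsMonotone {X Y : C} (P : InternalPreorder X) (Q : InternalPreorder Y) (f : X ⟶ Y) : Prop :=
  ∀ {I : C} (x y : I ⟶ X), P.le x y → Q.le (x ≫ f) (y ≫ f)

/-- The preorder induced on `Y` by a morphism `f : Y ⟶ X`: `x ≤ y` iff `f x ≤ f y`. The relation
object consists of the triples `(x, r, y)` with `f x = d₀ r` and `d₁ r = f y`. -/
noncomputable def induced [HasPullbacks C] {X Y : C} (P : InternalPreorder X) (f : Y ⟶ X) :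
    InternalPreorder Y where
  rel := pullback (pullback.snd f P.d₀ ≫ P.d₁) f
  d₀ := pullback.fst (pullback.snd f P.d₀ ≫ P.d₁) f ≫ pullback.fst f P.d₀
  d₁ := pullback.snd (pullback.snd f P.d₀ ≫ P.d₁) f
  jointly_mono := by
    intro I a b h₀ h₁
    have c := pullback.condition (f := pullback.snd f P.d₀ ≫ P.d₁) (g := f)
    have c' := pullback.condition (f := f) (g := P.d₀)
    refine pullback.hom_ext (pullback.hom_ext (by simpa only [Category.assoc] using h₀) ?_) h₁
    apply P.jointly_mono
    · simp only [Category.assoc, ← c']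
      simpa only [Category.assoc] using h₀ =≫ f
    · simp only [Category.assoc, c]
      simpa only [Category.assoc] using h₁ =≫ f
  refl := by
    obtain ⟨r, h₀, h₁⟩ := P.refl
    refine ⟨pullback.lift (pullback.lift (𝟙 Y) (f ≫ r) ?_) (𝟙 Y) ?_, ?_, ?_⟩
    · rw [Category.assoc, h₀, Category.id_comp, Category.comp_id]
    · rw [pullback.lift_snd_assoc, Category.assoc, h₁, Category.id_comp, Category.comp_id]
    · rw [pullback.lift_fst_assoc, pullback.lift_fst]
    · rw [pullback.lift_snd]
  trans := by
    intro I a b h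
    have c := pullback.condition (f := pullback.snd f P.d₀ ≫ P.d₁) (g := f)
    have c' := pullback.condition (f := f) (g := P.d₀)
    obtain ⟨k, k₀, k₁⟩ := P.trans
      (a ≫ pullback.fst (pullback.snd f P.d₀ ≫ P.d₁) f ≫ pullback.snd f P.d₀)
      (b ≫ pullback.fst (pullback.snd f P.d₀ ≫ P.d₁) f ≫ pullback.snd f P.d₀) (by
        simp only [Category.assoc, ← c', c]
        simpa only [Category.assoc] using h =≫ f)
    refine ⟨pullback.lift (pullback.lift
      (a ≫ pullback.fst (pullback.snd f P.d₀ ≫ P.d₁) f ≫ pullback.fst f P.d₀) k ?_)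
      (b ≫ pullback.snd (pullback.snd f P.d₀ ≫ P.d₁) f) ?_, ?_, ?_⟩
    · simp only [k₀, Category.assoc, c']
    · rw [pullback.lift_snd_assoc, k₁]
      simp only [Category.assoc, c]
    · rw [pullback.lift_fst_assoc, pullback.lift_fst]
    · rw [pullback.lift_snd]

lemma induced_le_iff [HasPullbacks C] {X Y : C} (P : InternalPreorder X) (f : Y ⟶ X) {I : C}
    (x y : I ⟶ Y) : (P.induced f).le x y ↔ P.le (x ≫ f) (y ≫ f) := by
  have c := pullback.condition (f := pullback.snd f P.d₀ ≫ P.d₁) (g := f)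
  have c' := pullback.condition (f := f) (g := P.d₀)
  constructor
  · rintro ⟨(h : I ⟶ pullback (pullback.snd f P.d₀ ≫ P.d₁) f), h0, h1⟩
    change h ≫ pullback.fst _ _ ≫ pullback.fst f P.d₀ = x at h0
    change h ≫ pullback.snd (pullback.snd f P.d₀ ≫ P.d₁) f = y at h1
    subst h0 h1
    refine ⟨h ≫ pullback.fst _ _ ≫ pullback.snd _ _, ?_, ?_⟩
    · simp only [Category.assoc, c']
    · simp only [Category.assoc] at c ⊢
      rw [c]
  · rintro ⟨h, h0, h1⟩
    refine ⟨pullback.lift (pullback.lift x h h0.symm) y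
      (by rw [pullback.lift_snd_assoc, h1]), ?_, ?_⟩
    · erw [pullback.lift_fst_assoc, pullback.lift_fst]
    · erw [pullback.lift_snd]

/-- The image of an internal preorder under a right adjoint functor. -/
def mapRightAdjoint {D : Type*} [Category* D] {L : D ⥤ C} {F : C ⥤ D} (adj : L ⊣ F)
    {X : C} (P : InternalPreorder X) : InternalPreorder (F.obj X) where
  rel := F.obj P.rel
  d₀ := F.map P.d₀
  d₁ := F.map P.d₁
  jointly_mono := by
    intro I a b h₀ h₁
    apply (adj.homEquiv _ _).symm.injective
    apply P.jointly_mono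
    · rw [← adj.homEquiv_naturality_right_symm, ← adj.homEquiv_naturality_right_symm, h₀]
    · rw [← adj.homEquiv_naturality_right_symm, ← adj.homEquiv_naturality_right_symm, h₁]
  refl := by
    obtain ⟨r, h₀, h₁⟩ := P.refl
    exact ⟨F.map r, by rw [← F.map_comp, h₀, F.map_id], by rw [← F.map_comp, h₁, F.map_id]⟩
  trans := by
    intro I a b h
    obtain ⟨c, c₀, c₁⟩ := P.trans ((adj.homEquiv _ _).symm a) ((adj.homEquiv _ _).symm b) (by
      rw [← adj.homEquiv_naturality_right_symm, ← adj.homEquiv_naturality_right_symm, h])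
    refine ⟨adj.homEquiv _ _ c, ?_, ?_⟩
    · rw [← adj.homEquiv_naturality_right, c₀, adj.homEquiv_naturality_right,
        Equiv.apply_symm_apply]
    · rw [← adj.homEquiv_naturality_right, c₁, adj.homEquiv_naturality_right,
        Equiv.apply_symm_apply]

/-- `P` is the internal preorder `Ω` of a morphism `p : E ⟶ Ω` (a generic mono): two generalized
elements of `Ω` are related iff the subobjects that they classify are included in one another. -/
def IsInclusionPreorder [HasPullbacks C] {E Ω : C} (p : E ⟶ Ω) [Mono p]
    (P : InternalPreorder Ω) : Prop :=
  ∀ {I : C} (x y : I ⟶ Ω), P.le x y ↔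
    (Subobject.pullback x).obj (Subobject.mk p) ≤ (Subobject.pullback y).obj (Subobject.mk p)

/-- A comonad on an internal preorder (in the 2-category of internal preorders): an internal
functor `β` with a counit `β ⇒ id` and a comultiplication `β ⇒ β β`. The comonad laws hold
automatically. -/
structure IsInternalComonad {X : C} (P : InternalPreorder X) (β : X ⟶ X) : Prop where
  monotone : P.IsMonotone P β
  counit : P.le β (𝟙 X)
  comult : P.le β (β ≫ β)

/-- An inserter of two internal functors `f g : P ⇉ Q`, in the 2-category of internal preorders:
the universal internal functor `ι` into `P` with a 2-cell `f ι ⇒ g ι`. -/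
structure Inserter {X Y : C} (P : InternalPreorder X) (Q : InternalPreorder Y)
    (f g : X ⟶ Y) where
  pt : C
  order : InternalPreorder pt
  ι : pt ⟶ X
  ι_monotone : order.IsMonotone P ι
  condition : Q.le (ι ≫ f) (ι ≫ g)
  exists_unique_lift : ∀ {Z : C} (R : InternalPreorder Z) (t : Z ⟶ X), R.IsMonotone P t →
    Q.le (t ≫ f) (t ≫ g) → ∃! s : Z ⟶ pt, R.IsMonotone order s ∧ s ≫ ι = t
  le_of_le : ∀ {Z : C} (s s' : Z ⟶ pt), P.le (s ≫ ι) (s' ≫ ι) → order.le s s'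

/-- The internal preorder of coalgebras of an internal comonad `β` on an internal preorder.
A coalgebra structure on an internal functor `t` into `P` is a 2-cell `t ⇒ β t` (the coalgebra
laws hold automatically), so that this is the inserter of the identity and `β`. -/
abbrev CoalgebraObject {X : C} (P : InternalPreorder X) (β : X ⟶ X) :=
  P.Inserter P (𝟙 X) β

end InternalPreorder

variable {C : Type u} [Category.{v} C]

/-- The endomorphism of the cofree coalgebra `F X` which is the transpose, across the
forgetful-cofree adjunction `U ⊣ F`, of a morphism `χ : U F X = □ X ⟶ X`. -/
def transposeEndo (G : Comonad C) {X : C} (χ : G.obj X ⟶ X) :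
    G.cofree.obj X ⟶ G.cofree.obj X :=
  G.adj.homEquiv (G.cofree.obj X) X χ

/-- The action of the cofree functor on internal preorders. -/
abbrev cofreePreorder (G : Comonad C) {X : C} (P : InternalPreorder X) :
    InternalPreorder (G.cofree.obj X) :=
  P.mapRightAdjoint G.adj

end HeytGen

namespace CategoryTheory.Subobject

variable {C : Type u} [Category.{v} C]

/-! The forgetful functor of a Cartesian comonad creates colimits and finite limits, so regularity
passes from the base category to coalgebras. For a coalgebra `A`, `forgetSubobject` embeds `Sub A`
into the subobjects of the carrier, commutes with pullback, and has a right adjoint `interior`. Its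
image consists of the open subobjects, those fixed by the interior operator, and contains all finite
joins of its members. Hence joins are computed on carriers, and `∀_f` is the interior of `∀` taken
on carriers.

For the generic mono, an element `x : I ⟶ F Ω` transposes to a map from the carrier of `I` to `Ω`,
and so classifies a subobject of that carrier. Under this reading the order on `F Ω` is inclusion,
and the transpose of `χ` acts as the interior operator (`classified_comp_transposeEndo`). This makes
it a comonad whose coalgebras are the elements classifying open subobjects, that is, subcoalgebras.
On `F E` the induced order is chaotic, so its inserter imposes no condition. A mono of coalgebras is
therefore classified by transposing a classifying square of its carrier
(`isGenericMono_of_comp_ι_eq`). -/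

lemma le_iff_forall_factors {X : C} {S T : Subobject X} :
    S ≤ T ↔ ∀ {I : C} (g : I ⟶ X), S.Factors g → T.Factors g :=
  ⟨fun h _ g hg => factors_of_le g h hg, fun h => le_of_factors (h _ S.factors_self)⟩

lemma mk_factors_iff_exists {X E I : C} (m : E ⟶ X) [Mono m] (g : I ⟶ X) :
    (mk m).Factors g ↔ ∃ k : I ⟶ E, k ≫ m = g :=
  mk_factors_iff m g

lemma top_le_iff_factors_id {X : C} (S : Subobject X) : ⊤ ≤ S ↔ S.Factors (𝟙 X) := by
  rw [top_eq_id, le_iff_forall_factors]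
  refine ⟨fun h => h _ (mk_factors_self _), fun h I g _ => ?_⟩
  simpa using factors_of_factors_right g h

lemma pullback_arrow_le_iff [HasPullbacks C] {X : C} (A S T : Subobject X) :
    (pullback A.arrow).obj S ≤ (pullback A.arrow).obj T ↔ A ⊓ S ≤ T := by
  simp only [le_iff_forall_factors, pullback_factors_iff, inf_factors]
  constructor
  · rintro h I g ⟨hA, hS⟩
    simpa using h (factorThru A g hA) (by simpa using hS)
  · exact fun h I g hS => h _ ⟨factors_comp_arrow g, hS⟩

end CategoryTheory.Subobject

/-! ### Heyting implication -/

namespace CategoryTheory.Regular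

variable {C : Type u} [Category.{v} C] [Regular C]

open CategoryTheory.Subobject

lemma exists_top_le_iff_factors {X I : C} (S : Subobject X) (h : I ⟶ X) :
    (Subobject.exists h).obj ⊤ ≤ S ↔ S.Factors h := by
  rw [(existsPullbackAdj h).gc.le_iff_le, top_le_iff_factors_id, pullback_factors_iff,
    Category.id_comp]

/-- The witness is the implication `A ⇒ B`, built as `∀` along `A` of the restriction of `B` to `A`.
Its generalized elements are read off from the image of `h`: Frobenius reciprocity turns `A ⊓ ∃_h ⊤
≤ B` into `∃_h (h⁻¹ A) ≤ B`, so no Beck–Chevalley condition is needed. -/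
lemma exists_factors_iff_pullback_le {X : C} (A B : Subobject X)
    [(Subobject.pullback A.arrow).IsLeftAdjoint] :
    ∃ H : Subobject X, ∀ {I : C} (h : I ⟶ X),
      H.Factors h ↔ (Subobject.pullback h).obj A ≤ (Subobject.pullback h).obj B := by
  refine ⟨(Functor.rightAdjoint (Subobject.pullback A.arrow)).obj ((Subobject.pullback A.arrow).obj B),
    fun {I} h => ?_⟩
  rw [← exists_top_le_iff_factors,
    ← (Adjunction.ofIsLeftAdjoint (Subobject.pullback A.arrow)).gc.le_iff_le,
    pullback_arrow_le_iff, inf_comm, ← exists_inf_pullback_eq_exists_inf, top_inf_eq,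
    (existsPullbackAdj h).gc.le_iff_le]

end CategoryTheory.Regular

/-! ### Coalgebras of a Cartesian comonad: limits and regularity -/

namespace CategoryTheory.Comonad

variable {C : Type u} [Category.{v} C]

section Transpose

variable {G : Comonad C}

/-- The transposition bijection of the forgetful-cofree adjunction. -/
def cofreeEquiv (Z : G.Coalgebra) (X : C) : (Z ⟶ G.cofree.obj X) ≃ (Z.A ⟶ X) :=
  (G.adj.homEquiv Z X).symm

lemma cofreeEquiv_comp_map {Z : G.Coalgebra} {X Y : C} (x : Z ⟶ G.cofree.obj X) (f : X ⟶ Y) :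
    cofreeEquiv Z Y (x ≫ G.cofree.map f) = cofreeEquiv Z X x ≫ f :=
  G.adj.homEquiv_naturality_right_symm x f

lemma cofreeEquiv_comp {Z' Z : G.Coalgebra} {X : C} (g : Z' ⟶ Z) (x : Z ⟶ G.cofree.obj X) :
    cofreeEquiv Z' X (g ≫ x) = g.f ≫ cofreeEquiv Z X x :=
  G.adj.homEquiv_naturality_left_symm g x

lemma f_eq_cofreeEquiv {Z : G.Coalgebra} {X : C} (x : Z ⟶ G.cofree.obj X) :
    x.f = Z.a ≫ G.map (cofreeEquiv Z X x) :=
  (congrArg Coalgebra.Hom.f (((cofreeEquiv Z X).symm_apply_apply x).symm.trans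
    (G.adj.homEquiv_unit Z X (cofreeEquiv Z X x)))).trans (by simp; rfl)

/-- The structure map of a coalgebra, as a morphism into a cofree coalgebra. -/
@[simps]
def coaction (A : G.Coalgebra) : A ⟶ G.cofree.obj A.A where
  f := A.a
  h := A.coassoc.symm

lemma cofreeEquiv_coaction (A : G.Coalgebra) : cofreeEquiv A A.A (coaction A) = 𝟙 A.A :=
  (G.adj.homEquiv_counit A A.A (coaction A)).trans (by rw [adj_counit]; exact A.counit)

end Transpose

section

variable {G : Comonad C} [HasFiniteLimits C] [PreservesFiniteLimits G.toFunctor]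

instance : HasFiniteLimits G.Coalgebra where
  out _ _ _ := ⟨fun D => forget_creates_limits_of_comonad_preserves D⟩

instance : PreservesFiniteLimits G.forget where
  preservesFiniteLimits _ _ _ := inferInstance

instance {A B : G.Coalgebra} (f : A ⟶ B) [Mono f] : Mono f.f :=
  inferInstanceAs (Mono (G.forget.map f))

end

/-- The kernel pair of `f` is sent to that of `f.f`, which has `f.f` as its coequalizer, and the
forgetful functor reflects coequalizers. -/
lemma isRegularEpi_of_forget {G : Comonad C} [HasPullbacks G.Coalgebra]
    [PreservesLimitsOfShape WalkingCospan G.forget] {A B : G.Coalgebra} (f : A ⟶ B)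
    (h : IsRegularEpi f.f) : IsRegularEpi f := by
  have sq : IsKernelPair f _ _ := IsPullback.of_hasPullback f f
  have sq' : IsKernelPair (G.forget.map f) _ _ := sq.map G.forget
  have : IsRegularEpi (G.forget.map f) := h
  exact ⟨⟨⟨_, _, _, sq.w, isColimitOfIsColimitCoforkMap G.forget sq.w sq'.toCoequalizer'⟩⟩⟩

lemma isRegularEpi_forget {G : Comonad C} {A B : G.Coalgebra} (f : A ⟶ B) (h : IsRegularEpi f) :
    IsRegularEpi f.f := by
  obtain ⟨⟨W, l, r, w, hc⟩⟩ := h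
  exact ⟨⟨⟨_, _, _, _, isColimitCoforkMapOfIsColimit G.forget w hc⟩⟩⟩

instance regular_coalgebra [Regular C] (G : Comonad C) [PreservesFiniteLimits G.toFunctor] :
    Regular G.Coalgebra where
  hasCoequalizer_of_isKernelPair {X Y Z f g₁ g₂} sq := by
    have : HasCoequalizer (G.forget.map g₁) (G.forget.map g₂) :=
      Regular.hasCoequalizer_of_isKernelPair (sq.map G.forget)
    have : HasColimit (parallelPair g₁ g₂ ⋙ G.forget) :=
      hasColimit_of_iso (F := parallelPair (G.forget.map g₁) (G.forget.map g₂))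
        (diagramIsoParallelPair _)
    exact hasColimit_of_comp_forget_hasColimit _
  regularEpiIsStableUnderBaseChange := ⟨fun sq h => isRegularEpi_of_forget _
    (Regular.regularEpiIsStableUnderBaseChange.of_isPullback (sq.map G.forget)
      (isRegularEpi_forget _ h))⟩

/-! ### Subcoalgebras and the interior operator -/

section Subobjects

open CategoryTheory.Subobject

variable [HasFiniteLimits C] {G : Comonad C} [PreservesFiniteLimits G.toFunctor]

/-- Compatibility of `l` with the structure maps can be tested after composing with `G.map m.f`,
which is monic because `G` preserves finite limits. -/
lemma exists_lift_of_comp_eq {Z X A : G.Coalgebra} (m : X ⟶ A) [Mono m] (g : Z ⟶ A)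
    (l : Z.A ⟶ X.A) (hl : l ≫ m.f = g.f) : ∃ k : Z ⟶ X, k ≫ m = g := by
  refine ⟨⟨l, ?_⟩, by ext; exact hl⟩
  rw [← cancel_mono (G.map m.f), Category.assoc, Category.assoc, ← G.map_comp, hl, m.h,
    reassoc_of% hl, g.h]

/-- The subobject of the carrier of a coalgebra underlying a subobject of the coalgebra. -/
noncomputable def forgetSubobject (A : G.Coalgebra) (S : Subobject A) : Subobject A.A :=
  Subobject.mk S.arrow.f

lemma forgetSubobject_factors_iff {Z A : G.Coalgebra} (S : Subobject A) (g : Z ⟶ A) :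
    (forgetSubobject A S).Factors g.f ↔ S.Factors g := by
  rw [forgetSubobject, mk_factors_iff_exists]
  conv_rhs => rw [← mk_arrow S, mk_factors_iff_exists]
  exact ⟨fun ⟨l, hl⟩ => exists_lift_of_comp_eq _ _ l hl, fun ⟨k, hk⟩ => ⟨k.f, by rw [← hk]; rfl⟩⟩

lemma forgetSubobject_mk {X A : G.Coalgebra} (m : X ⟶ A) [Mono m] :
    forgetSubobject A (.mk m) = .mk m.f :=
  mk_eq_mk_of_comm _ _ (G.forget.mapIso (underlyingIso m))
    (congrArg Coalgebra.Hom.f (underlyingIso_hom_comp_eq_mk m))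

lemma forgetSubobject_le_iff {A : G.Coalgebra} (S T : Subobject A) :
    forgetSubobject A S ≤ forgetSubobject A T ↔ S ≤ T := by
  constructor
  · intro h
    refine le_of_factors ((forgetSubobject_factors_iff _ _).1 (factors_of_le _ h ?_))
    exact (forgetSubobject_factors_iff _ _).2 S.factors_self
  · intro h
    exact mk_le_mk_of_comm (ofLE S T h).f (congrArg Coalgebra.Hom.f (ofLE_arrow h))

lemma forgetSubobject_pullback {A B : G.Coalgebra} (f : A ⟶ B) (S : Subobject B) :
    forgetSubobject A ((Subobject.pullback f).obj S) =
      (Subobject.pullback f.f).obj (forgetSubobject B S) :=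
  have sq : IsPullback (Subobject.pullbackπ f S).f ((Subobject.pullback f).obj S).arrow.f
      S.arrow.f f.f := (isPullback f S).map G.forget
  (pullback_obj_mk sq).symm

omit [HasFiniteLimits C] [PreservesFiniteLimits G.toFunctor] in
instance {X Y : C} (m : X ⟶ Y) [Mono m] : Mono (G.cofree.map m) :=
  have := G.adj.isRightAdjoint
  inferInstance

/-- The largest subobject of a coalgebra contained in a given subobject of its carrier. -/
noncomputable def interior (A : G.Coalgebra) (T : Subobject A.A) : Subobject A :=
  (Subobject.pullback (coaction A)).obj (.mk (G.cofree.map T.arrow))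

lemma forgetSubobject_interior (A : G.Coalgebra) (T : Subobject A.A) :
    forgetSubobject A (interior A T) = (Subobject.pullback A.a).obj (.mk (G.map T.arrow)) := by
  rw [interior, forgetSubobject_pullback, forgetSubobject_mk]
  rfl

/-- Transposition matches lifts of `g ≫ coaction A` through the cofree image of `T` with lifts of
`g.f` through `T`. -/
lemma interior_factors_iff {Z A : G.Coalgebra} (T : Subobject A.A) (g : Z ⟶ A) :
    (interior A T).Factors g ↔ T.Factors g.f := by
  rw [interior, pullback_factors_iff, mk_factors_iff_exists]
  conv_rhs => rw [← T.mk_arrow, mk_factors_iff_exists]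
  have hc : cofreeEquiv Z A.A (g ≫ coaction A) = g.f := by
    rw [cofreeEquiv_comp, cofreeEquiv_coaction, Category.comp_id]
  constructor
  · rintro ⟨k, hk⟩
    exact ⟨cofreeEquiv _ _ k, by rw [← cofreeEquiv_comp_map, hk, hc]⟩
  · rintro ⟨k, hk⟩
    refine ⟨(cofreeEquiv _ _).symm k, (cofreeEquiv _ _).injective ?_⟩
    rw [cofreeEquiv_comp_map, Equiv.apply_symm_apply, hk, hc]

lemma gc_forgetSubobject_interior (A : G.Coalgebra) :
    GaloisConnection (forgetSubobject A) (interior A) := by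
  intro S T
  constructor
  · intro h
    exact le_of_factors ((interior_factors_iff _ _).2
      (factors_of_le _ h ((forgetSubobject_factors_iff _ _).2 S.factors_self)))
  · intro h
    rw [forgetSubobject, ← T.mk_arrow]
    have := (interior_factors_iff _ _).1 (factors_of_le _ h S.factors_self)
    exact mk_le_mk_of_comm _ (factorThru_arrow _ _ this)

lemma le_interior_forgetSubobject {A : G.Coalgebra} (S : Subobject A) :
    S ≤ interior A (forgetSubobject A S) :=
  (gc_forgetSubobject_interior A).le_u_l S

lemma isBot_forgetSubobject_iff {A : G.Coalgebra} (S : Subobject A) :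
    IsBot (forgetSubobject A S) ↔ IsBot S :=
  ⟨fun h _ => (forgetSubobject_le_iff _ _).1 (h _),
    fun h _ => (gc_forgetSubobject_interior A).l_le (h _)⟩

lemma isLUB_forgetSubobject_iff {A : G.Coalgebra} (S T W : Subobject A) :
    IsLUB {forgetSubobject A S, forgetSubobject A T} (forgetSubobject A W) ↔ IsLUB {S, T} W := by
  symm
  constructor
  · intro h
    simpa [Set.image_pair] using (gc_forgetSubobject_interior A).isLUB_l_image h
  · intro h
    refine IsLUB.of_image (f := forgetSubobject A) (forgetSubobject_le_iff _ _) ?_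
    simpa [Set.image_pair] using h

lemma forgetSubobject_interior_eq_of_isBot {A : G.Coalgebra} {T : Subobject A.A} (h : IsBot T) :
    forgetSubobject A (interior A T) = T :=
  le_antisymm ((gc_forgetSubobject_interior A).l_u_le T) (h _)

/-- A join of open subobjects is open: its interior already contains both of them, by adjunction. -/
lemma forgetSubobject_interior_eq_of_isLUB {A : G.Coalgebra} {S T : Subobject A}
    {W : Subobject A.A} (h : IsLUB {forgetSubobject A S, forgetSubobject A T} W) :
    forgetSubobject A (interior A W) = W := by
  refine le_antisymm ((gc_forgetSubobject_interior A).l_u_le W) (h.2 ?_)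
  have gc := gc_forgetSubobject_interior A
  rintro _ (rfl | rfl)
  · exact gc.monotone_l (gc.le_u (h.1 (by simp)))
  · exact gc.monotone_l (gc.le_u (h.1 (by simp)))

end Subobjects

instance heytingCategory_coalgebra [HeytGen.HeytingCategory C] (G : Comonad C)
    [PreservesFiniteLimits G.toFunctor] : HeytGen.HeytingCategory G.Coalgebra where
  exists_isBot A := by
    obtain ⟨T, hT⟩ := HeytGen.CoherentCategory.exists_isBot A.A
    refine ⟨interior A T, (isBot_forgetSubobject_iff _).1 ?_⟩
    rwa [forgetSubobject_interior_eq_of_isBot hT]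
  exists_isLUB {A} S T := by
    obtain ⟨W, hW⟩ :=
      HeytGen.CoherentCategory.exists_isLUB (forgetSubobject A S) (forgetSubobject A T)
    refine ⟨interior A W, (isLUB_forgetSubobject_iff _ _ _).1 ?_⟩
    rwa [forgetSubobject_interior_eq_of_isLUB hW]
  pullback_isBot f S hS := by
    rw [← isBot_forgetSubobject_iff] at hS ⊢
    rw [forgetSubobject_pullback]
    exact HeytGen.CoherentCategory.pullback_isBot _ _ hS
  pullback_isLUB f S T W hW := by
    rw [← isLUB_forgetSubobject_iff] at hW ⊢
    simp only [forgetSubobject_pullback]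
    exact HeytGen.CoherentCategory.pullback_isLUB _ _ _ _ hW
  pullback_isLeftAdjoint {A B} f := by
    have := HeytGen.HeytingCategory.pullback_isLeftAdjoint f.f
    have gcf := (Adjunction.ofIsLeftAdjoint (Subobject.pullback f.f)).gc
    -- The right adjoint composes `∀` on carriers with the interior; it suffices to chain the two
    -- adjunctions.
    have gc : GaloisConnection (Subobject.pullback f).obj fun S : Subobject A =>
        interior B ((Subobject.pullback f.f).rightAdjoint.obj (forgetSubobject A S)) := fun T S => by
      rw [← (gc_forgetSubobject_interior B).le_iff_le, ← gcf.le_iff_le,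
        ← forgetSubobject_pullback, forgetSubobject_le_iff]
    exact gc.adjunction.isLeftAdjoint

end CategoryTheory.Comonad

/-! ### Internal preorders and inserters -/

namespace HeytGen

namespace InternalPreorder

variable {C : Type u} [Category.{v} C]

section Basic

variable {X Y : C} (P : InternalPreorder X)

lemma le_comp {P : InternalPreorder X} {I J : C} {x y : I ⟶ X} (h : P.le x y) (g : J ⟶ I) :
    P.le (g ≫ x) (g ≫ y) := by
  obtain ⟨k, rfl, rfl⟩ := h
  exact ⟨g ≫ k, by simp, by simp⟩

lemma le_refl {I : C} (x : I ⟶ X) : P.le x x := by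
  obtain ⟨r, h₀, h₁⟩ := P.refl
  exact ⟨x ≫ r, by simp [h₀], by simp [h₁]⟩

/-- The discrete preorder, whose relation is the diagonal. -/
def discrete (X : C) : InternalPreorder X where
  rel := X
  d₀ := 𝟙 X
  d₁ := 𝟙 X
  jointly_mono a b h _ := by simpa using h
  refl := ⟨𝟙 X, by simp, by simp⟩
  trans a b h := ⟨a, rfl, by simpa using h⟩

lemma eq_of_discrete_le {I : C} {x y : I ⟶ X} (h : (discrete X).le x y) : x = y := by
  obtain ⟨k, rfl, rfl⟩ := h
  rfl

lemma discrete_isMonotone (f : X ⟶ Y) (Q : InternalPreorder Y) : (discrete X).IsMonotone Q f :=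
  fun x y h => by rw [eq_of_discrete_le h]; exact Q.le_refl _

end Basic

namespace Inserter

variable {X Y : C} {P : InternalPreorder X} {Q : InternalPreorder Y} {f g : X ⟶ Y}

lemma le_iff (K : P.Inserter Q f g) {Z : C} (s s' : Z ⟶ K.pt) :
    K.order.le s s' ↔ P.le (s ≫ K.ι) (s' ≫ K.ι) :=
  ⟨fun h => K.ι_monotone _ _ h, K.le_of_le s s'⟩

lemma condition_comp (K : P.Inserter Q f g) {Z : C} (s : Z ⟶ K.pt) :
    Q.le ((s ≫ K.ι) ≫ f) ((s ≫ K.ι) ≫ g) := by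
  simpa using le_comp K.condition s

/-- Every morphism out of a discrete preorder is monotone, so the universal property applies to bare
morphisms. -/
lemma exists_lift (K : P.Inserter Q f g) {Z : C} (t : Z ⟶ X) (h : Q.le (t ≫ f) (t ≫ g)) :
    ∃ s : Z ⟶ K.pt, s ≫ K.ι = t := by
  obtain ⟨s, ⟨-, hs⟩, -⟩ := K.exists_unique_lift (discrete Z) t (discrete_isMonotone _ _) h
  exact ⟨s, hs⟩

lemma mono_ι (K : P.Inserter Q f g) : Mono K.ι := by
  refine ⟨fun {Z} a b hab => ?_⟩
  refine (K.exists_unique_lift (discrete Z) (b ≫ K.ι) (discrete_isMonotone _ _)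
    (K.condition_comp b)).unique ⟨discrete_isMonotone _ _, hab⟩ ⟨discrete_isMonotone _ _, rfl⟩

variable (P Q f g) in
-- The inserter is the pullback of the relation of `Q` along `(f, g)`, with the order induced from
-- `P`.
lemma nonempty_of_hasFiniteLimits [HasFiniteLimits C] : Nonempty (P.Inserter Q f g) := by
  have hm : Mono (prod.lift Q.d₀ Q.d₁) := ⟨fun a b h => Q.jointly_mono a b
    (by simpa [prod.lift_fst] using h =≫ prod.fst)
    (by simpa [prod.lift_snd] using h =≫ prod.snd)⟩
  let ι : pullback (prod.lift f g) (prod.lift Q.d₀ Q.d₁) ⟶ X := pullback.fst _ _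
  have hι : Mono ι := inferInstanceAs (Mono (pullback.fst _ _))
  have c : ι ≫ prod.lift f g = pullback.snd _ _ ≫ prod.lift Q.d₀ Q.d₁ := pullback.condition
  refine ⟨⟨_, P.induced ι, ι, fun x y h => (P.induced_le_iff ι x y).1 h,
    ⟨pullback.snd (prod.lift f g) (prod.lift Q.d₀ Q.d₁), ?_, ?_⟩, ?_,
    fun s s' h => (P.induced_le_iff ι s s').2 h⟩⟩
  · simpa [prod.lift_fst] using (c =≫ prod.fst).symm
  · simpa [prod.lift_snd] using (c =≫ prod.snd).symm
  · rintro Z R t ht ⟨h, h₀, h₁⟩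
    have ht' : t ≫ prod.lift f g = h ≫ prod.lift Q.d₀ Q.d₁ := by
      ext <;> simp [h₀, h₁]
    have hs : pullback.lift t h ht' ≫ ι = t := pullback.lift_fst _ _ _
    refine ⟨pullback.lift t h ht', ⟨fun x y hxy => (P.induced_le_iff ι _ _).2 ?_, hs⟩, ?_⟩
    · simpa only [Category.assoc, hs] using ht x y hxy
    · rintro s ⟨-, hs'⟩
      rw [← cancel_mono ι, hs', hs]

end Inserter

lemma mapRightAdjoint_le_iff {D : Type*} [Category* D] {L : D ⥤ C} {F : C ⥤ D} (adj : L ⊣ F)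
    {X : C} (P : InternalPreorder X) {I : D} (x y : I ⟶ F.obj X) :
    (P.mapRightAdjoint adj).le x y ↔
      P.le ((adj.homEquiv I X).symm x) ((adj.homEquiv I X).symm y) := by
  constructor
  · rintro ⟨h, rfl, rfl⟩
    exact ⟨(adj.homEquiv _ _).symm h, (adj.homEquiv_naturality_right_symm _ _).symm,
      (adj.homEquiv_naturality_right_symm _ _).symm⟩
  · rintro ⟨h, h₀, h₁⟩
    refine ⟨adj.homEquiv _ _ h, ?_, ?_⟩
    · exact (adj.homEquiv_naturality_right _ _).symm.trans (by rw [h₀, Equiv.apply_symm_apply])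
    · exact (adj.homEquiv_naturality_right _ _).symm.trans (by rw [h₁, Equiv.apply_symm_apply])

section Inclusion

variable [HeytingCategory C] {E Ω : C} (p : E ⟶ Ω) [Mono p]

/-- The relation is the implication, in `Sub (Ω ⨯ Ω)`, between the pullbacks of `p` along the two
projections. -/
lemma exists_isInclusionPreorder : ∃ P : InternalPreorder Ω, P.IsInclusionPreorder p := by
  have := HeytingCategory.pullback_isLeftAdjoint
    ((Subobject.pullback (prod.fst : Ω ⨯ Ω ⟶ Ω)).obj (.mk p)).arrow
  obtain ⟨H, hH⟩ := Regular.exists_factors_iff_pullback_le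
    ((Subobject.pullback (prod.fst : Ω ⨯ Ω ⟶ Ω)).obj (.mk p))
    ((Subobject.pullback (prod.snd : Ω ⨯ Ω ⟶ Ω)).obj (.mk p))
  have key {I : C} (x y : I ⟶ Ω) : (∃ h : I ⟶ (H : C), h ≫ H.arrow ≫ prod.fst = x ∧
      h ≫ H.arrow ≫ prod.snd = y) ↔
      (Subobject.pullback x).obj (.mk p) ≤ (Subobject.pullback y).obj (.mk p) := by
    have := hH (prod.lift x y)
    rw [← Subobject.pullback_comp, ← Subobject.pullback_comp, prod.lift_fst, prod.lift_snd] at this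
    rw [← this]
    constructor
    · rintro ⟨h, rfl, rfl⟩
      convert Subobject.factors_comp_arrow h using 1
      ext <;> simp [prod.lift_fst, prod.lift_snd]
    · exact fun h =>
        ⟨Subobject.factorThru _ _ h, by simp [prod.lift_fst], by simp [prod.lift_snd]⟩
  refine ⟨⟨H, H.arrow ≫ prod.fst, H.arrow ≫ prod.snd, fun a b h₀ h₁ => ?_, ?_,
    fun a b h => ?_⟩, key⟩
  · rw [← cancel_mono H.arrow]
    ext
    · simpa using h₀
    · simpa using h₁
  · exact (key _ _).2 le_rfl
  · refine (key _ _).2 (((key _ _).1 ⟨a, rfl, rfl⟩).trans ?_)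
    rw [h]
    exact (key _ _).1 ⟨b, rfl, rfl⟩

/-- An element of `Ω` that factors through `p` classifies the top subobject, so the induced order is
chaotic. -/
lemma IsInclusionPreorder.induced_le {P : InternalPreorder Ω} (hP : P.IsInclusionPreorder p)
    {I : C} (x y : I ⟶ E) : (P.induced p).le x y := by
  rw [P.induced_le_iff, hP, Subobject.le_iff_forall_factors]
  intro J g _
  rw [pullback_factors_iff, ← Category.assoc]
  exact Subobject.factors_of_factors_right _ (Subobject.mk_factors_self p)

end Inclusion

end InternalPreorder

/-! ### The generic monomorphism of coalgebras -/

section Coalgebras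

open InternalPreorder Comonad

variable {C : Type u} [Category.{v} C]

lemma cofreeEquiv_transposeEndo (G : Comonad C) {X : C} (χ : G.obj X ⟶ X) :
    cofreeEquiv _ X (transposeEndo G χ) = χ :=
  (G.adj.homEquiv (G.cofree.obj X) X).symm_apply_apply χ

lemma cofreeEquiv_comp_transposeEndo {G : Comonad C} {X : C} (χ : G.obj X ⟶ X) {I : G.Coalgebra}
    (x : I ⟶ G.cofree.obj X) :
    cofreeEquiv I X (x ≫ transposeEndo G χ) = (I.a ≫ G.map (cofreeEquiv I X x)) ≫ χ := by
  rw [cofreeEquiv_comp, cofreeEquiv_transposeEndo, f_eq_cofreeEquiv]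
  rfl

lemma cofreePreorder_le_iff {G : Comonad C} {X : C} (P : InternalPreorder X) {I : G.Coalgebra}
    (x y : I ⟶ G.cofree.obj X) :
    (cofreePreorder G P).le x y ↔ P.le (cofreeEquiv I X x) (cofreeEquiv I X y) :=
  mapRightAdjoint_le_iff _ _ _ _

variable {G : Comonad C}

lemma transposeEndo_comp_map {E X : C} {p : E ⟶ X} {χE : G.obj E ⟶ E} {χ : G.obj X ⟶ X}
    (w : χE ≫ p = G.map p ≫ χ) :
    transposeEndo G χE ≫ G.cofree.map p = G.cofree.map p ≫ transposeEndo G χ := by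
  apply (cofreeEquiv _ _).injective
  rw [cofreeEquiv_comp_map, cofreeEquiv_comp, cofreeEquiv_transposeEndo, cofreeEquiv_transposeEndo]
  exact w

lemma cofreePreorder_isMonotone {X Y : C} {P : InternalPreorder X} {Q : InternalPreorder Y}
    {f : X ⟶ Y} (hf : P.IsMonotone Q f) :
    (cofreePreorder G P).IsMonotone (cofreePreorder G Q) (G.cofree.map f) := by
  intro I x y h
  rw [cofreePreorder_le_iff] at h ⊢
  rw [cofreeEquiv_comp_map, cofreeEquiv_comp_map]
  exact hf _ _ h

variable [HeytingCategory C] [PreservesFiniteLimits G.toFunctor] {E Ω : C} {p : E ⟶ Ω} [Mono p]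
  {P : InternalPreorder Ω} {χE : G.obj E ⟶ E} {χ : G.obj Ω ⟶ Ω}

/-- The subobject of the carrier of `I` which is classified by the transpose of a generalized
element of `F Ω`. -/
noncomputable def classified (p : E ⟶ Ω) [Mono p] {I : G.Coalgebra} (x : I ⟶ G.cofree.obj Ω) :
    Subobject I.A :=
  (Subobject.pullback (cofreeEquiv I Ω x)).obj (.mk p)

omit [PreservesFiniteLimits G.toFunctor] in
lemma cofreePreorder_le_iff_classified_le (hP : P.IsInclusionPreorder p) {I : G.Coalgebra}
    (x y : I ⟶ G.cofree.obj Ω) :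
    (cofreePreorder G P).le x y ↔ classified p x ≤ classified p y :=
  (cofreePreorder_le_iff _ _ _).trans (hP _ _)

/-- The transpose of the composite is `I.a`, then `G` of the transpose of `x`, then `χ`. Pulling `p`
back along `χ` gives `G.map p`; since `G` preserves pullbacks, the next step gives `G` of the
classified subobject, and pulling that back along `I.a` is the interior. -/
lemma classified_comp_transposeEndo (hχ : IsPullback χE (G.map p) p χ) {I : G.Coalgebra}
    (x : I ⟶ G.cofree.obj Ω) :
    classified p (x ≫ transposeEndo G χ) = forgetSubobject I (interior I (classified p x)) := by
  unfold classified
  rw [forgetSubobject_interior, cofreeEquiv_comp_transposeEndo,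
    Subobject.pullback_comp, Subobject.pullback_comp, Subobject.pullback_obj_mk hχ]
  congr 1
  have sq : IsPullback (Subobject.pullbackπ (cofreeEquiv I Ω x) (.mk p))
    ((Subobject.pullback (cofreeEquiv I Ω x)).obj (.mk p)).arrow (Subobject.mk p).arrow
    (cofreeEquiv I Ω x) := Subobject.isPullback _ _
  rw [← Subobject.pullback_obj_mk (sq.map G.toFunctor)]
  congr 1
  exact (Subobject.mk_eq_mk_of_comm _ _ (G.mapIso (Subobject.underlyingIso p))
    (by rw [Functor.mapIso_hom, ← G.map_comp, Subobject.underlyingIso_hom_comp_eq_mk])).symm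

/-- These are the laws of the kernel operator of the adjunction between `forgetSubobject` and
`interior`; counit and comultiplication are checked on the universal element `𝟙`. -/
lemma isInternalComonad_transposeEndo (hP : P.IsInclusionPreorder p)
    (hχ : IsPullback χE (G.map p) p χ) :
    (cofreePreorder G P).IsInternalComonad (transposeEndo G χ) where
  monotone x y h := by
    rw [cofreePreorder_le_iff_classified_le hP] at h ⊢
    rw [classified_comp_transposeEndo hχ, classified_comp_transposeEndo hχ]
    have gc := gc_forgetSubobject_interior (G := G)
    exact (gc _).monotone_l ((gc _).monotone_u h)
  counit := by
    rw [cofreePreorder_le_iff_classified_le hP, ← Category.id_comp (transposeEndo G χ),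
      classified_comp_transposeEndo hχ]
    exact (gc_forgetSubobject_interior _).l_u_le _
  comult := by
    have h := classified_comp_transposeEndo hχ (𝟙 _)
    rw [Category.id_comp] at h
    rw [cofreePreorder_le_iff_classified_le hP, classified_comp_transposeEndo hχ, h]
    have gc := gc_forgetSubobject_interior (G.cofree.obj Ω)
    exact gc.monotone_l (gc.le_u_l _)

omit [PreservesFiniteLimits G.toFunctor] in
lemma cofreePreorder_induced_le (hP : P.IsInclusionPreorder p) {I : G.Coalgebra}
    (x y : I ⟶ G.cofree.obj E) : (cofreePreorder G (P.induced p)).le x y :=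
  (cofreePreorder_le_iff _ _ _).2 (hP.induced_le p _ _)

omit [HeytingCategory C] in
lemma isInternalComonad_of_forall_le {X : C} {Q : InternalPreorder X} {β : X ⟶ X}
    (h : ∀ {I : C} (x y : I ⟶ X), Q.le x y) : Q.IsInternalComonad β :=
  ⟨fun _ _ _ => h _ _, h _ _, h _ _⟩

lemma isGenericMono_of_comp_ι_eq (hp : IsGenericMono p) (hP : P.IsInclusionPreorder p)
    (hχ : IsPullback χE (G.map p) p χ)
    (K : (cofreePreorder G P).CoalgebraObject (transposeEndo G χ))
    (KE : (cofreePreorder G (P.induced p)).CoalgebraObject (transposeEndo G χE))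
    (q : KE.pt ⟶ K.pt) (hq : q ≫ K.ι = KE.ι ≫ G.cofree.map p) : IsGenericMono q := by
  have := K.mono_ι
  have := KE.mono_ι
  have hqm : Mono q := mono_of_mono_fac hq
  refine ⟨hqm, fun {X Y} m _ => ?_⟩
  obtain ⟨t, u, sq⟩ := hp.exists_isPullback m.f
  let x := (cofreeEquiv Y Ω).symm u
  let y := (cofreeEquiv X E).symm t
  have hx : cofreeEquiv Y Ω x = u := Equiv.apply_symm_apply _ _
  have hy : cofreeEquiv X E y = t := Equiv.apply_symm_apply _ _
  have hmx : y ≫ G.cofree.map p = m ≫ x := (cofreeEquiv _ _).injective (by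
    rw [cofreeEquiv_comp_map, cofreeEquiv_comp, hx, hy, sq.w])
  have hcl : classified p x = forgetSubobject Y (.mk m) := by
    rw [classified, hx, forgetSubobject_mk, Subobject.pullback_obj_mk sq]
  -- The inserter condition says that the carrier of `m` is open, which holds because `m` is a mono
  -- of coalgebras.
  obtain ⟨c, hc⟩ := K.exists_lift x (by
    rw [cofreePreorder_le_iff_classified_le hP, classified_comp_transposeEndo hχ, Category.comp_id,
      hcl, forgetSubobject_le_iff]
    exact le_interior_forgetSubobject _)
  obtain ⟨t', ht'⟩ := KE.exists_lift y (cofreePreorder_induced_le hP _ _)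
  have w : t' ≫ q = m ≫ c := by
    rw [← cancel_mono K.ι, Category.assoc, hq, reassoc_of% ht', hmx, Category.assoc, hc]
  -- The universal property is transposed to the classifying square on carriers; the lift found
  -- there is automatically a coalgebra morphism.
  have ex {Z : G.Coalgebra} (a : Z ⟶ KE.pt) (b : Z ⟶ Y) (hab : a ≫ q = b ≫ c) :
      ∃ l : Z ⟶ X, l ≫ m = b := by
    have h : (a ≫ KE.ι) ≫ G.cofree.map p = b ≫ x := by
      rw [Category.assoc, ← hq, reassoc_of% hab, hc]
    replace h := congrArg (cofreeEquiv _ _) h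
    rw [cofreeEquiv_comp_map, cofreeEquiv_comp b, hx] at h
    exact exists_lift_of_comp_eq m b (sq.lift _ _ h) (sq.lift_snd _ _ h)
  choose l hl using @ex
  refine ⟨t', c, ⟨w⟩, ⟨PullbackCone.IsLimit.mk w (fun s => l s.fst s.snd s.condition) (fun s => ?_)
    (fun s => hl _ _ _) (fun s k _ hk => ?_)⟩⟩
  · rw [← cancel_mono q, Category.assoc, w, reassoc_of% hl, s.condition]
  · rw [← cancel_mono m, hk, hl]

/-- The construction of a generic monomorphism of coalgebras from a generic monomorphism `p`. -/
theorem cofree_construction (hp : IsGenericMono p) (hP : P.IsInclusionPreorder p)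
    (hχ : IsPullback χE (G.map p) p χ) :
    (cofreePreorder G P).IsInternalComonad (transposeEndo G χ) ∧
    (cofreePreorder G (P.induced p)).IsInternalComonad (transposeEndo G χE) ∧
    (cofreePreorder G (P.induced p)).IsMonotone (cofreePreorder G P) (G.cofree.map p) ∧
    transposeEndo G χE ≫ G.cofree.map p = G.cofree.map p ≫ transposeEndo G χ ∧
    Nonempty ((cofreePreorder G P).CoalgebraObject (transposeEndo G χ)) ∧
    Nonempty ((cofreePreorder G (P.induced p)).CoalgebraObject (transposeEndo G χE)) ∧
    ∀ (K : (cofreePreorder G P).CoalgebraObject (transposeEndo G χ))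
      (KE : (cofreePreorder G (P.induced p)).CoalgebraObject (transposeEndo G χE)),
      (∃! q : KE.pt ⟶ K.pt, KE.order.IsMonotone K.order q ∧ q ≫ K.ι = KE.ι ≫ G.cofree.map p) ∧
      ∀ q : KE.pt ⟶ K.pt, q ≫ K.ι = KE.ι ≫ G.cofree.map p → IsGenericMono q := by
  have hm : (cofreePreorder G (P.induced p)).IsMonotone (cofreePreorder G P) (G.cofree.map p) :=
    cofreePreorder_isMonotone fun x y h => (P.induced_le_iff p x y).1 h
  have hβ := transposeEndo_comp_map (G := G) hχ.w
  refine ⟨isInternalComonad_transposeEndo hP hχ,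
    isInternalComonad_of_forall_le (cofreePreorder_induced_le hP), hm, hβ,
    Inserter.nonempty_of_hasFiniteLimits _ _ _ _, Inserter.nonempty_of_hasFiniteLimits _ _ _ _,
    fun K KE => ⟨?_, isGenericMono_of_comp_ι_eq hp hP hχ K KE⟩⟩
  refine K.exists_unique_lift KE.order _ (fun x y h => ?_) ?_
  · simpa only [Category.assoc] using hm _ _ (KE.ι_monotone x y h)
  · simpa only [Category.assoc, hβ, Category.comp_id, Category.id_comp] using hm _ _ KE.condition

end Coalgebras

end HeytGen

theorem mainTheorem6 {C : Type u} [Category.{v} C] [HeytGen.HeytingCategory C]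
    (hC : HeytGen.HasGenericMono C) (G : Comonad C) [PreservesFiniteLimits G.toFunctor] :
    -- the category of coalgebras is a Heyting category with a generic mono
    HeytGen.HeytingCategory G.Coalgebra ∧ HeytGen.HasGenericMono G.Coalgebra ∧
    -- construction of a generic mono of coalgebras from any generic mono `p : E ⟶ Ω`
    ∀ {E Ω : C} (p : E ⟶ Ω) [Mono p], HeytGen.IsGenericMono p →
      (∃ P : HeytGen.InternalPreorder Ω, P.IsInclusionPreorder p) ∧
      (∃ (χE : G.obj E ⟶ E) (χ : G.obj Ω ⟶ Ω), IsPullback χE (G.map p) p χ) ∧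
      ∀ (P : HeytGen.InternalPreorder Ω) (χE : G.obj E ⟶ E) (χ : G.obj Ω ⟶ Ω),
        P.IsInclusionPreorder p → IsPullback χE (G.map p) p χ →
        -- the transposes of `χ`, `χE` are internal comonads, and `F p` is a strict morphism
        (HeytGen.cofreePreorder G P).IsInternalComonad (HeytGen.transposeEndo G χ) ∧
        (HeytGen.cofreePreorder G (P.induced p)).IsInternalComonad
          (HeytGen.transposeEndo G χE) ∧
        (HeytGen.cofreePreorder G (P.induced p)).IsMonotone (HeytGen.cofreePreorder G P)
          (G.cofree.map p) ∧
        HeytGen.transposeEndo G χE ≫ G.cofree.map p =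
          G.cofree.map p ≫ HeytGen.transposeEndo G χ ∧
        -- the objects of coalgebras exist, and the induced morphism between them is generic
        Nonempty ((HeytGen.cofreePreorder G P).CoalgebraObject (HeytGen.transposeEndo G χ)) ∧
        Nonempty ((HeytGen.cofreePreorder G (P.induced p)).CoalgebraObject
          (HeytGen.transposeEndo G χE)) ∧
        ∀ (K : (HeytGen.cofreePreorder G P).CoalgebraObject (HeytGen.transposeEndo G χ))
          (KE : (HeytGen.cofreePreorder G (P.induced p)).CoalgebraObject
            (HeytGen.transposeEndo G χE)),
          (∃! q : KE.pt ⟶ K.pt, KE.order.IsMonotone K.order q ∧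
            q ≫ K.ι = KE.ι ≫ G.cofree.map p) ∧
          ∀ q : KE.pt ⟶ K.pt, q ≫ K.ι = KE.ι ≫ G.cofree.map p → HeytGen.IsGenericMono q := by
  have main {E Ω : C} (p : E ⟶ Ω) [Mono p] (hp : HeytGen.IsGenericMono p) :
      ∃ (χE : G.obj E ⟶ E) (χ : G.obj Ω ⟶ Ω), IsPullback χE (G.map p) p χ :=
    hp.exists_isPullback (G.map p)
  refine ⟨inferInstance, ?_, fun p _ hp => ⟨HeytGen.InternalPreorder.exists_isInclusionPreorder p,
    main p hp, fun P χE χ hP hχ => HeytGen.cofree_construction hp hP hχ⟩⟩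
  obtain ⟨E, Ω, p, hp⟩ := hC
  have := hp.mono
  obtain ⟨P, hP⟩ := HeytGen.InternalPreorder.exists_isInclusionPreorder p
  obtain ⟨χE, χ, hχ⟩ := main p hp
  obtain ⟨-, -, -, -, ⟨K⟩, ⟨KE⟩, h⟩ := HeytGen.cofree_construction hp hP hχ
  obtain ⟨⟨q, ⟨-, hq⟩, -⟩, hgen⟩ := h K KE
  exact ⟨_, _, q, hgen q hq⟩
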